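/- Let $n\ge 2$. Let $D_n$ be the set of permutations $\pi$ of $\{\pm1,\dots,\pm n\}$ with $\pi(-i)=-\pi(i)$ for all $i$ and with an even number of $i\in\{1,\dots,n\}$ such that $\pi(i)<0$. For $\pi\in D_n$ let $\mathrm{des}_D(\pi)$ be the number of $i\in\{1,\dots,n-1\}$ with $\pi(i)>\pi(i+1)$, increased by one if $\pi(1)+\pi(2)<0$, and let $D_{n,k}=|\{\pi\in D_n:\mathrm{des}_D(\pi)=k\}|$ be the Eulerian numbers of type $D$. Let $B_n(\cdot)$ be the $n$-th Bernoulli polynomial, $B(n)=B_n(0)$ the $n$-th Bernoulli number, and $\binom{y}{n}=y(y-1)\cdots(y-n+1)/n!$. Then, as an identity of polynomials in $x$ (equivalently, for every element $x$ of every field of characteristic zero), $$(1+2x)^n-2^{n-1}\bigl(B_n(x+1)-B(n)\bigr)=\sum_{k=0}^n\binom{n+x-k}{n}D_{n,k}.$$ In particular, in its power-sum form, for every integer $m\ge 0$, $$(1+2m)^n-2^{n-1}\,n\,\bigl(1^{n-1}+2^{n-1}+\cdots+m^{n-1}\bigr)=\sum_{k=0}^n\binom{n+m-k}{n}D_{n,k}.$$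 -/

import Mathlib

namespace SignedPerm

/-- The alphabet `{±1, ±2, …, ±n}`. -/
abbrev Letter (n : ℕ) : Type := {z : ℤ // z ∈ (Finset.Icc (-(n : ℤ)) n).erase 0}

/-- The letter `-a`. -/
instance (n : ℕ) : Neg (Letter n) where
  neg a := ⟨-a.1, by
    have h := a.2
    simp only [Finset.mem_erase, Finset.mem_Icc] at h ⊢
    omega⟩

/-- The value `π(i)` as an integer, for `i ∈ {±1, …, ±n}`, with the convention `π(0) = 0`
(and value `0` also outside the alphabet). -/
noncomputable def val {n : ℕ} (π : Equiv.Perm (Letter n)) (i : ℤ) : ℤ :=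
  if h : i ∈ (Finset.Icc (-(n : ℤ)) n).erase 0 then (π ⟨i, h⟩ : ℤ) else 0

/-- `neg(π)`: the number of `i ∈ {1, …, n}` with `π(i) < 0`. -/
noncomputable def neg {n : ℕ} (π : Equiv.Perm (Letter n)) : ℕ :=
  ((Finset.Icc 1 n).filter fun i : ℕ => val π i < 0).card

/-- `B_n`: the signed permutations, i.e. the permutations `π` of `{±1, …, ±n}` with
`π(-i) = -π(i)`. -/
noncomputable def groupB (n : ℕ) : Finset (Equiv.Perm (Letter n)) :=
  Finset.univ.filter fun π => ∀ a, π (-a) = -π a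

/-- `D_n`: the signed permutations with an even number of negative elements among
`π(1), …, π(n)`. -/
noncomputable def groupD (n : ℕ) : Finset (Equiv.Perm (Letter n)) :=
  (groupB n).filter fun π => Even (neg π)

/-- `Des_A(π) = {i : 1 ≤ i ≤ n - 1, π(i) > π(i+1)}`. -/
noncomputable def DesA {n : ℕ} (π : Equiv.Perm (Letter n)) : Finset ℕ :=
  (Finset.Ico 1 n).filter fun i : ℕ => val π i > val π (i + 1)

/-- `Des_D(π)`: `Des_A(π)`, together with `0` when `π(1) + π(2) < 0`. (For a signed permutation
and `n ≥ 2` the sum `π(1) + π(2)` is never `0`.) -/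
noncomputable def DesD {n : ℕ} (π : Equiv.Perm (Letter n)) : Finset ℕ :=
  if val π 1 + val π 2 < 0 then insert 0 (DesA π) else DesA π

/-- `des_D(π) = |Des_D(π)|`. -/
noncomputable def desD {n : ℕ} (π : Equiv.Perm (Letter n)) : ℕ := (DesD π).card

/-- The Eulerian number of type `D`: the number of `π ∈ D_n` with `des_D(π) = k`. -/
noncomputable def eulerianD (n k : ℕ) : ℕ := ((groupD n).filter fun π => desD π = k).card

end SignedPerm

/-! For a permutation with descent set `D`, the number $\binom{n+m-|D|}{n}$ counts sequences $0\le
a_0\le\dots\le a_{n-1}\le m$ whose steps are strict at `D` (`card_strictSeq`). So the right-hand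
side at $x=m$ counts pairs of some $\pi\in D_n$ and a sequence compatible with its type $D$ descents
(`sum_choose_mul_eulerianD`).

Changing the sign of the letter $\pm1$ preserves the type $D$ descent set and reverses the parity of
the number of minus signs. Hence twice this count is the same sum over all signed permutations
(`sum_groupD`).

Placing $a_i$ on the letter $|\pi(i+1)|$ turns such a pair into a function from letters to signed
values in $\{0,\dots,m\}$. The permutation is recovered by sorting by value and then by signed
letter. Only the descent at $0$ leaves a constraint: the least value is positive, or the two first
letters have nonnegative sum (`sum_card_strictSeq`).

These functions are counted directly. There are $(2m)^n$ with positive least value. The others are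
classified by the first letter, its sign and the second value; geometric sums and a telescoping sum
give $2(1+2m)^n-n2^n\sum_{j\le m}j^{n-1}$ in total (`card_admissible_eq`). Halving yields the
power-sum form. Faulhaber's formula rewrites it with Bernoulli polynomials, and agreement at all
natural numbers forces a polynomial identity. -/

namespace SignedPerm

section

open Finset

/-! ### Counting sequences with prescribed strict steps -/

/-- The weakly increasing sequences `0 ≤ a₀ ≤ ⋯ ≤ aₙ₋₁ ≤ m` whose step into position `j` is
strict for each `j ∈ D`. -/
def strictSeq (n m : ℕ) (D : Finset ℕ) : Finset (Fin n → ℕ) :=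
  (Fintype.piFinset fun _ => range (m + 1)).filter fun a =>
    ∀ j : Fin n, (if (j : ℕ) ∈ D then 1 else 0) ≤ a j ∧
      ∀ i < j, a i + (if (j : ℕ) ∈ D then 1 else 0) ≤ a j

theorem mem_strictSeq {n m : ℕ} {D : Finset ℕ} {a : Fin n → ℕ} :
    a ∈ strictSeq n m D ↔ (∀ j, a j ≤ m) ∧
      ∀ j : Fin n, (if (j : ℕ) ∈ D then 1 else 0) ≤ a j ∧
        ∀ i < j, a i + (if (j : ℕ) ∈ D then 1 else 0) ≤ a j := by
  simp [strictSeq, Fintype.mem_piFinset]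

theorem card_strictSeq_fiber (n m c : ℕ) (D : Finset ℕ) (hc : c ≤ m)
    (hD : (if n ∈ D then 1 else 0) ≤ c) :
    ((strictSeq (n + 1) m D).filter fun a => a (Fin.last n) = c).card =
      (strictSeq n (c - if n ∈ D then 1 else 0) D).card := by
  refine Finset.card_bij' (fun a _ => Fin.init a) (fun a _ => Fin.snoc a c) ?_ ?_ ?_ ?_
  · intro a ha
    rw [mem_filter, mem_strictSeq] at ha
    obtain ⟨⟨h1, h2⟩, h3⟩ := ha
    rw [mem_strictSeq]
    refine ⟨fun j => ?_, fun j => ⟨(h2 j.castSucc).1, fun i hi => (h2 j.castSucc).2 i.castSucc hi⟩⟩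
    have := (h2 (Fin.last n)).2 j.castSucc (Fin.castSucc_lt_last j)
    rw [h3] at this
    simp only [Fin.val_last] at this
    simp only [Fin.init]
    omega
  · intro a ha
    rw [mem_strictSeq] at ha
    obtain ⟨h1, h2⟩ := ha
    rw [mem_filter, mem_strictSeq]
    refine ⟨⟨fun j => ?_, fun j => ?_⟩, by simp⟩
    · induction j using Fin.lastCases with
      | last => simpa using hc
      | cast j => have := h1 j; simp only [Fin.snoc_castSucc]; omega
    · induction j using Fin.lastCases with
      | last =>
        refine ⟨by simpa using hD, fun i hi => ?_⟩
        induction i using Fin.lastCases with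
        | last => exact absurd hi (lt_irrefl _)
        | cast i =>
          have := h1 i
          simp only [Fin.snoc_castSucc, Fin.snoc_last, Fin.val_last]; omega
      | cast j =>
        refine ⟨by simpa using (h2 j).1, fun i hi => ?_⟩
        induction i using Fin.lastCases with
        | last => exact absurd hi (not_lt.2 (Fin.le_last _))
        | cast i => simpa using (h2 j).2 i hi
  · intro a ha
    rw [mem_filter] at ha
    rw [← ha.2]
    exact Fin.snoc_init_self a
  · intro a _
    exact Fin.init_snoc (α := fun _ => ℕ) c a

theorem sum_choose_hockey (n d : ℕ) (hd : d ≤ n) (m : ℕ) :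
    ∑ c ∈ range m, (n + c - d).choose n = (n + m - d).choose (n + 1) := by
  induction m with
  | zero => simp [Nat.choose_eq_zero_of_lt (show n - d < n + 1 by omega)]
  | succ m ih =>
    rw [sum_range_succ, ih, show n + (m + 1) - d = (n + m - d) + 1 by omega,
      Nat.choose_succ_succ, add_comm]

/-- Induction on the length: fixing the last value leaves a shorter sequence with a smaller bound,
and the fibre sizes add up by the hockey-stick identity. -/
theorem card_strictSeq (n m : ℕ) (D : Finset ℕ) :
    (strictSeq n m D).card = (n + m - (D.filter (· < n)).card).choose n := by
  induction n generalizing m with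
  | zero =>
    have : strictSeq 0 m D = univ :=
      eq_univ_of_forall fun a => mem_strictSeq.2 ⟨fun j => j.elim0, fun j => j.elim0⟩
    simp [this]
  | succ n ih =>
    have hle : (D.filter (· < n)).card ≤ n := by
      calc _ ≤ (range n).card := card_le_card fun x hx => by
            simpa using (mem_filter.1 hx).2
        _ = n := card_range n
    rw [card_eq_sum_card_fiberwise (f := fun a => a (Fin.last n)) (t := range (m + 1))
      (fun a ha => by
        have := (mem_strictSeq.1 ha).1 (Fin.last n)
        simp; omega)]
    by_cases hn : n ∈ D
    · have hD : (D.filter (· < n + 1)).card = (D.filter (· < n)).card + 1 := by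
        rw [← card_insert_of_notMem (a := n) (s := D.filter (· < n)) (by simp)]
        congr 1; ext x; simp only [mem_filter, mem_insert]
        constructor
        · rintro ⟨h1, h2⟩
          rcases eq_or_ne x n with h | h
          · exact Or.inl h
          · exact Or.inr ⟨h1, by omega⟩
        · rintro (rfl | ⟨h1, h2⟩)
          · exact ⟨hn, by omega⟩
          · exact ⟨h1, by omega⟩
      -- A strict last step excludes last value 0, and last value `c + 1` leaves the bound `c`.
      rw [sum_range_succ', hD]
      have h0 : ((strictSeq (n + 1) m D).filter fun a => a (Fin.last n) = 0) = ∅ := by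
        refine filter_eq_empty_iff.2 fun a ha h => ?_
        have := ((mem_strictSeq.1 ha).2 (Fin.last n)).1
        simp [hn, h] at this
      rw [h0, card_empty, add_zero, show n + 1 + m - ((D.filter (· < n)).card + 1) =
        n + m - (D.filter (· < n)).card by omega, ← sum_choose_hockey n _ hle]
      refine sum_congr rfl fun c hc => ?_
      rw [mem_range] at hc
      rw [card_strictSeq_fiber n m (c + 1) D (by omega) (by simp [hn]), ih]
      simp [hn]
    · have hD : D.filter (· < n + 1) = D.filter (· < n) := by
        ext x; simp only [mem_filter]
        refine and_congr_right fun h => ?_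
        have : x ≠ n := by rintro rfl; exact hn h
        omega
      rw [hD, show n + 1 + m = n + (m + 1) by omega, ← sum_choose_hockey n _ hle]
      refine sum_congr rfl fun c hc => ?_
      rw [mem_range] at hc
      rw [card_strictSeq_fiber n m c D (by omega) (by simp [hn]), ih]
      simp [hn]

/-! ### Sorting coloured functions by value and signed letter -/

/-- The letter `j + 1` with sign `ε`, where `ε = true` stands for a minus sign. -/
def letter {n : ℕ} (j : Fin n) (ε : Bool) : ℤ := if ε then -((j : ℤ) + 1) else (j : ℤ) + 1

@[simp] theorem letter_true {n : ℕ} (j : Fin n) : letter j true = -((j : ℤ) + 1) := rfl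

@[simp] theorem letter_false {n : ℕ} (j : Fin n) : letter j false = (j : ℤ) + 1 := rfl

theorem natAbs_letter {n : ℕ} (j : Fin n) (ε : Bool) : (letter j ε).natAbs = j + 1 := by
  cases ε <;> simp <;> omega

theorem letter_ne {n : ℕ} {i j : Fin n} (h : i ≠ j) (ε δ : Bool) : letter i ε ≠ letter j δ := by
  intro he
  have := congrArg Int.natAbs he
  rw [natAbs_letter, natAbs_letter] at this
  exact h (Fin.ext (by omega))

/-- The sorting key of a coloured function: first the value, then the signed letter. -/
def sortKey {n : ℕ} (x : Fin n → ℕ × Bool) (j : Fin n) : ℕ ×ₗ ℤ :=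
  toLex ((x j).1, letter j (x j).2)

theorem sortKey_lt_iff {n : ℕ} {x : Fin n → ℕ × Bool} {i j : Fin n} :
    sortKey x i < sortKey x j ↔ (x i).1 < (x j).1 ∨
      (x i).1 = (x j).1 ∧ letter i (x i).2 < letter j (x j).2 :=
  Prod.Lex.toLex_lt_toLex

theorem sortKey_injective {n : ℕ} (x : Fin n → ℕ × Bool) : Function.Injective (sortKey x) := by
  intro i j h
  by_contra hij
  exact letter_ne hij (x i).2 (x j).2 (congrArg (fun z => (ofLex z).2) h)

theorem sort_eq_iff_strictMono {n : ℕ} {α : Type*} [LinearOrder α] {f : Fin n → α}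
    (hf : Function.Injective f) (σ : Equiv.Perm (Fin n)) :
    Tuple.sort f = σ ↔ StrictMono (f ∘ σ) := by
  constructor
  · rintro rfl
    exact (Tuple.monotone_sort f).strictMono_of_injective (hf.comp (Equiv.injective _))
  · intro h
    have := Tuple.unique_monotone (Tuple.monotone_sort f) h.monotone
    exact Equiv.ext fun i => hf (congrFun this i)

/-- Sequences with prescribed strict steps are the ones for which the pairs of values
and letters increase lexicographically. -/
theorem mem_strictSeq_iff_strictMono {n m : ℕ} {D : Finset ℕ} {v : Fin (n + 1) → ℤ}
    (hv : Function.Injective v) (hD : ∀ i : Fin n, (i : ℕ) + 1 ∈ D ↔ v i.succ < v i.castSucc)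
    {a : Fin (n + 1) → ℕ} :
    a ∈ strictSeq (n + 1) m D ↔ (∀ j, a j ≤ m) ∧ (0 ∈ D → 0 < a 0) ∧
      StrictMono fun i => toLex (a i, v i) := by
  rw [mem_strictSeq]
  refine and_congr_right fun _ => ?_
  constructor
  · intro h
    refine ⟨fun h0 => ?_, Fin.strictMono_iff_lt_succ.2 fun i => ?_⟩
    · have := (h 0).1
      simp only [Fin.val_zero, h0, if_true] at this
      omega
    · rw [Prod.Lex.toLex_lt_toLex]
      have h1 := (h i.succ).2 i.castSucc (Fin.castSucc_lt_succ)
      rw [Fin.val_succ] at h1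
      by_cases hd : (i : ℕ) + 1 ∈ D
      · rw [if_pos hd] at h1
        exact Or.inl h1
      · rw [if_neg hd] at h1
        rw [hD, not_lt] at hd
        rcases h1.lt_or_eq with h2 | h2
        · exact Or.inl h2
        · exact Or.inr ⟨h2, lt_of_le_of_ne hd fun he =>
            (Fin.castSucc_lt_succ (i := i)).ne (hv he)⟩
  · rintro ⟨h0, hm⟩ j
    have hmono : Monotone a := fun i j hij => by
      rcases Prod.Lex.toLex_le_toLex.1 (hm.monotone hij) with h | h
      · exact h.le
      · exact h.1.le
    have step : ∀ i < j, a i + (if (j : ℕ) ∈ D then 1 else 0) ≤ a j := by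
      intro i hi
      induction j using Fin.cases with
      | zero => exact absurd hi (Fin.not_lt_zero i)
      | succ j =>
        have h1 : a i ≤ a j.castSucc := hmono (Fin.le_castSucc_iff.2 hi)
        have h2 := Prod.Lex.toLex_lt_toLex.1 (hm (Fin.castSucc_lt_succ (i := j)))
        rw [Fin.val_succ]
        split_ifs with hd
        · rw [hD] at hd
          rcases h2 with h2 | h2
          · simp only at h2; omega
          · exact absurd h2.2 hd.not_gt
        · rcases h2 with h2 | h2 <;> simp only at h2 <;> omega
    refine ⟨?_, step⟩
    rcases Fin.eq_zero_or_eq_succ j with rfl | ⟨j, rfl⟩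
    · split_ifs with hd
      · exact h0 hd
      · exact Nat.zero_le _
    · have := step 0 (Fin.succ_pos j)
      omega

/-- Functions with values in `{0, …, m}`, each value carrying a sign. -/
def coloured (n m : ℕ) : Finset (Fin n → ℕ × Bool) :=
  Fintype.piFinset fun _ => range (m + 1) ×ˢ univ

theorem mem_coloured {n m : ℕ} {x : Fin n → ℕ × Bool} :
    x ∈ coloured n m ↔ ∀ j, (x j).1 ≤ m := by
  simp [coloured, Fintype.mem_piFinset]

/-- If the values of `x` are sorted by `sortKey`, then either the smallest value is positive, or
the two first letters have nonnegative sum. -/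
def Admissible {n : ℕ} (x : Fin (n + 2) → ℕ × Bool) : Prop :=
  0 < (x (Tuple.sort (sortKey x) 0)).1 ∨
    0 ≤ letter (Tuple.sort (sortKey x) 0) (x (Tuple.sort (sortKey x) 0)).2 +
      letter (Tuple.sort (sortKey x) 1) (x (Tuple.sort (sortKey x) 1)).2

instance {n : ℕ} : DecidablePred (Admissible (n := n)) := fun _ => instDecidableOr

/-- Every coloured function has a unique sorting permutation because its keys are distinct. The
fibre over `(σ, s)` consists of the functions whose values, read along `σ`, increase
lexicographically together with the letters. This forces a strict step exactly at the descents, and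
`0 ∈ D c` becomes `Admissible`. -/
theorem sum_card_strictSeq {n : ℕ} (m : ℕ)
    (D : Equiv.Perm (Fin (n + 2)) × (Fin (n + 2) → Bool) → Finset ℕ)
    (hD : ∀ c, ∀ i : Fin (n + 1), (i : ℕ) + 1 ∈ D c ↔
      letter (c.1 i.succ) (c.2 (c.1 i.succ)) < letter (c.1 i.castSucc) (c.2 (c.1 i.castSucc)))
    (hD0 : ∀ c, 0 ∈ D c ↔ letter (c.1 0) (c.2 (c.1 0)) + letter (c.1 1) (c.2 (c.1 1)) < 0) :
    ∑ c, (strictSeq (n + 2) m (D c)).card =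
      ((coloured (n + 2) m).filter Admissible).card := by
  rw [card_eq_sum_card_fiberwise
    (f := fun x => ((Tuple.sort (sortKey x), fun j => (x j).2) :
      Equiv.Perm (Fin (n + 2)) × (Fin (n + 2) → Bool))) (t := univ) (fun _ _ => mem_univ _)]
  refine sum_congr rfl fun c _ => ?_
  obtain ⟨σ, s⟩ := c
  have hv : Function.Injective fun i => letter (σ i) (s (σ i)) := fun i j h => by
    by_contra hij
    exact letter_ne (σ.injective.ne hij) _ _ h
  have key : ∀ a : Fin (n + 2) → ℕ, (sortKey fun j => (a (σ.symm j), s j)) ∘ σ =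
      fun i => toLex (a i, letter (σ i) (s (σ i))) := fun a => by
    funext i; simp [sortKey]
  -- Sequences are indexed by positions and coloured functions by letters; `σ` translates between
  -- them.
  refine card_bij' (fun a _ j => (a (σ.symm j), s j)) (fun x _ i => (x (σ i)).1) ?_ ?_ ?_ ?_
  · intro a ha
    rw [mem_strictSeq_iff_strictMono hv (hD (σ, s))] at ha
    have hs : Tuple.sort (sortKey fun j => (a (σ.symm j), s j)) = σ := by
      rw [sort_eq_iff_strictMono (sortKey_injective _), key]
      exact ha.2.2
    rw [mem_filter, mem_filter, mem_coloured, Admissible, hs]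
    refine ⟨⟨fun j => ha.1 _, ?_⟩, rfl⟩
    have := ha.2.1
    rw [hD0] at this
    simp only [Equiv.symm_apply_apply]
    by_cases h : 0 < a 0
    · exact Or.inl h
    · exact Or.inr (not_lt.1 fun h' => h (this h'))
  · intro x hx
    rw [mem_filter, mem_filter, mem_coloured, Prod.mk.injEq] at hx
    obtain ⟨⟨hm, hA⟩, hσ, rfl⟩ := hx
    rw [mem_strictSeq_iff_strictMono hv (hD (σ, _)), hD0]
    rw [Admissible, hσ] at hA
    refine ⟨fun j => hm _, fun h => hA.resolve_right (not_le.2 h), ?_⟩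
    exact (sort_eq_iff_strictMono (sortKey_injective _) _).1 hσ
  · intro a _
    simp
  · intro x hx
    rw [mem_filter, Prod.mk.injEq] at hx
    obtain ⟨_, _, rfl⟩ := hx
    simp

/-! ### Counting admissible functions -/

/-- The values allowed at `j` when `p` is the first letter, with sign `ε` and value `0`, and the
remaining values are at least `α`. -/
def upperCell {n : ℕ} (m : ℕ) (p : Fin n) (ε : Bool) (α : ℕ) (j : Fin n) : Finset (ℕ × Bool) :=
  if j = p then {(0, ε)} else
    (range (m + 1) ×ˢ univ).filter fun y =>
      -- A letter of value `α` must have nonnegative sum with the first letter and, if `α = 0`, must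
      -- exceed it. Beyond `p` this means a plus sign. Below `p` the sum has the sign of the first
      -- letter, so `ε` must be plus; but then `j` would precede `p` if `α = 0`.
      α < y.1 ∨ y.1 = α ∧ if j < p then ε = false ∧ α ≠ 0 else y.2 = false

/-- The values allowed at `j` when `p` has sign `ε` and value `0`, and the remaining values are
greater than `α`. -/
def lowerCell {n : ℕ} (m : ℕ) (p : Fin n) (ε : Bool) (α : ℕ) (j : Fin n) : Finset (ℕ × Bool) :=
  if j = p then {(0, ε)} else (range (m + 1) ×ˢ univ).filter fun y => α < y.1

theorem lowerCell_subset_upperCell {n m : ℕ} (p : Fin n) (ε : Bool) (α : ℕ) (j : Fin n) :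
    lowerCell m p ε α j ⊆ upperCell m p ε α j := by
  unfold lowerCell upperCell
  split_ifs
  · exact Subset.rfl
  · exact monotone_filter_right _ fun y _ hy => Or.inl hy
  · exact monotone_filter_right _ fun y _ hy => Or.inl hy

theorem mem_piFinset_upperCell {n m : ℕ} {p : Fin n} {ε : Bool} {α : ℕ} {x : Fin n → ℕ × Bool} :
    x ∈ Fintype.piFinset (upperCell m p ε α) ↔ x p = (0, ε) ∧ ∀ j ≠ p, (x j).1 ≤ m ∧
      (α < (x j).1 ∨ (x j).1 = α ∧ if j < p then ε = false ∧ α ≠ 0 else (x j).2 = false) := by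
  rw [Fintype.mem_piFinset]
  constructor
  · intro h
    refine ⟨by simpa [upperCell] using h p, fun j hj => ?_⟩
    have := h j
    rw [upperCell, if_neg hj, mem_filter, mem_product, mem_range] at this
    exact ⟨by omega, this.2⟩
  · rintro ⟨h1, h2⟩ j
    by_cases hj : j = p
    · subst hj; simp [upperCell, h1]
    · rw [upperCell, if_neg hj, mem_filter, mem_product, mem_range]
      have := h2 j hj
      exact ⟨⟨by omega, mem_univ _⟩, this.2⟩

theorem mem_piFinset_lowerCell {n m : ℕ} {p : Fin n} {ε : Bool} {α : ℕ} {x : Fin n → ℕ × Bool} :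
    x ∈ Fintype.piFinset (lowerCell m p ε α) ↔ x p = (0, ε) ∧
      ∀ j ≠ p, (x j).1 ≤ m ∧ α < (x j).1 := by
  rw [Fintype.mem_piFinset]
  constructor
  · intro h
    refine ⟨by simpa [lowerCell] using h p, fun j hj => ?_⟩
    have := h j
    rw [lowerCell, if_neg hj, mem_filter, mem_product, mem_range] at this
    exact ⟨by omega, this.2⟩
  · rintro ⟨h1, h2⟩ j
    by_cases hj : j = p
    · subst hj; simp [lowerCell, h1]
    · rw [lowerCell, if_neg hj, mem_filter, mem_product, mem_range]
      have := h2 j hj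
      exact ⟨⟨by omega, mem_univ _⟩, this.2⟩

theorem sort_zero_le {n : ℕ} {x : Fin (n + 2) → ℕ × Bool} (j : Fin (n + 2)) :
    sortKey x (Tuple.sort (sortKey x) 0) ≤ sortKey x j := by
  have := Tuple.monotone_sort (sortKey x) (Fin.zero_le ((Tuple.sort (sortKey x)).symm j))
  simpa using this

theorem sort_one_le {n : ℕ} {x : Fin (n + 2) → ℕ × Bool} {j : Fin (n + 2)}
    (hj : j ≠ Tuple.sort (sortKey x) 0) :
    sortKey x (Tuple.sort (sortKey x) 1) ≤ sortKey x j := by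
  have h0 : (Tuple.sort (sortKey x)).symm j ≠ 0 := fun h => hj (by rw [← h]; simp)
  have := Tuple.monotone_sort (sortKey x) (Fin.one_le_of_ne_zero h0)
  simpa using this

theorem sort_one_ne {n : ℕ} (x : Fin (n + 2) → ℕ × Bool) :
    Tuple.sort (sortKey x) 1 ≠ Tuple.sort (sortKey x) 0 := by
  simp

theorem sortKey_le_iff {n : ℕ} {x : Fin n → ℕ × Bool} {i j : Fin n} :
    sortKey x i ≤ sortKey x j ↔ (x i).1 < (x j).1 ∨
      (x i).1 = (x j).1 ∧ letter i (x i).2 ≤ letter j (x j).2 :=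
  Prod.Lex.toLex_le_toLex

theorem mem_upperCell_sdiff_of_admissible {n m : ℕ} {x : Fin (n + 2) → ℕ × Bool}
    {p q : Fin (n + 2)} (hm : ∀ j, (x j).1 ≤ m) (hpq : q ≠ p) (hp : ∀ j, sortKey x p ≤ sortKey x j)
    (hq : ∀ j ≠ p, sortKey x q ≤ sortKey x j) (h0 : (x p).1 = 0)
    (hA : 0 ≤ letter p (x p).2 + letter q (x q).2) :
    x ∈ Fintype.piFinset (upperCell m p (x p).2 (x q).1) \
      Fintype.piFinset (lowerCell m p (x p).2 (x q).1) := by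
  rw [mem_sdiff, mem_piFinset_upperCell, mem_piFinset_lowerCell]
  refine ⟨⟨Prod.ext h0 rfl, fun j hj => ⟨hm j, ?_⟩⟩, fun h => lt_irrefl _ (h.2 q hpq).2⟩
  rcases sortKey_le_iff.1 (hq j hj) with h | ⟨h, hle⟩
  · exact Or.inl h
  refine Or.inr ⟨h.symm, ?_⟩
  have hne : (j : ℕ) ≠ p := fun h => hj (Fin.ext h)
  have hqp : (q : ℕ) ≠ p := fun h => hpq (Fin.ext h)
  have hpj := sortKey_le_iff.1 (hp j)
  split_ifs with hlt
  · rw [Fin.lt_def] at hlt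
    generalize (x p).2 = e at *
    generalize (x q).2 = f at *
    generalize (x j).2 = g at *
    cases e <;> cases f <;> cases g <;>
      simp only [letter_true, letter_false, Bool.true_eq_false, false_and, true_and] at * <;> omega
  · rw [Fin.lt_def] at hlt
    generalize (x p).2 = e at *
    generalize (x q).2 = f at *
    generalize (x j).2 = g at *
    cases e <;> cases f <;> cases g <;>
      simp only [letter_true, letter_false, Bool.true_eq_false] at * <;> omega

/-- The second letter is the least one among those of value `α`, so its sum with the first letter is
nonnegative exactly when this holds for all of them. The condition therefore splits into independent
conditions on each letter. Subtracting the lower product ensures that `α` is attained. -/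
theorem fiber_admissible {n : ℕ} (m : ℕ) (p : Fin (n + 2)) (ε : Bool) (α : ℕ) :
    (((coloured (n + 2) m).filter fun x => Admissible x ∧
        (x (Tuple.sort (sortKey x) 0)).1 = 0).filter fun x =>
      (Tuple.sort (sortKey x) 0, (x (Tuple.sort (sortKey x) 0)).2,
        (x (Tuple.sort (sortKey x) 1)).1) = (p, ε, α)) =
      Fintype.piFinset (upperCell m p ε α) \ Fintype.piFinset (lowerCell m p ε α) := by
  ext x
  constructor
  · intro hx
    rw [mem_filter, mem_filter, mem_coloured, Prod.mk.injEq, Prod.mk.injEq] at hx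
    obtain ⟨⟨hm, hA, h0⟩, rfl, rfl, rfl⟩ := hx
    exact mem_upperCell_sdiff_of_admissible hm (sort_one_ne x) sort_zero_le
      (fun j => sort_one_le) h0 (hA.resolve_left (by omega))
  · intro hx
    rw [mem_sdiff, mem_piFinset_upperCell, mem_piFinset_lowerCell] at hx
    obtain ⟨⟨hxp, hU⟩, hV⟩ := hx
    -- Lying outside the lower product supplies a letter `r` of value at most `α`, which bounds the
    -- second value from above.
    have hV' : ∃ j ≠ p, (x j).1 ≤ α := by
      by_contra! h
      exact hV ⟨hxp, fun j hj => ⟨(hU j hj).1, h j hj⟩⟩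
    obtain ⟨r, hr, hrα⟩ := hV'
    have hp1 : (x p).1 = 0 := by rw [hxp]
    have hp2 : (x p).2 = ε := by rw [hxp]
    have hmin : ∀ j ≠ p, sortKey x p < sortKey x j := by
      intro j hj
      rw [sortKey_lt_iff, hp1]
      rcases Nat.eq_zero_or_pos (x j).1 with h | h
      swap
      · exact Or.inl h
      refine Or.inr ⟨h.symm, ?_⟩
      have hj' : (j : ℕ) ≠ p := fun h => hj (Fin.ext h)
      obtain h1 | ⟨h1, h2⟩ := (hU j hj).2
      · omega
      split_ifs at h2 with hlt
      · omega
      · rw [Fin.lt_def] at hlt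
        rw [h2]
        cases (x p).2 <;> simp only [letter_true, letter_false] <;> omega
    have hσ0 : Tuple.sort (sortKey x) 0 = p := by
      by_contra h
      exact absurd (sort_zero_le p) (hmin _ h).not_ge
    have hne := sort_one_ne x
    have hle := fun j => sort_one_le (x := x) (j := j)
    rw [hσ0] at hne hle
    rw [mem_filter, mem_filter, mem_coloured, Admissible, hσ0]
    generalize Tuple.sort (sortKey x) 1 = q at hne hle
    obtain ⟨-, hq⟩ := hU q hne
    have hqα : (x q).1 = α := by
      have := sortKey_le_iff.1 (hle r hr)
      omega
    refine ⟨⟨fun j => ?_, Or.inr ?_, hp1⟩, ?_⟩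
    · by_cases hj : j = p
      · rw [hj, hp1]; exact Nat.zero_le _
      · exact (hU j hj).1
    · have hq' : (q : ℕ) ≠ p := fun h => hne (Fin.ext h)
      obtain h1 | ⟨h1, h2⟩ := hq
      · omega
      rw [hp2]
      split_ifs at h2 with hlt
      · rw [Fin.lt_def] at hlt
        rw [h2.1]
        cases (x q).2 <;> simp only [letter_true, letter_false] <;> omega
      · rw [Fin.lt_def] at hlt
        rw [h2]
        cases ε <;> simp only [letter_true, letter_false] <;> omega
    · rw [hp2, hqα]

theorem card_filter_product_univ (m α : ℕ) :
    ((range (m + 1) ×ˢ (univ : Finset Bool)).filter fun y => α < y.1).card = 2 * (m - α) := by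
  have : ((range (m + 1) ×ˢ (univ : Finset Bool)).filter fun y => α < y.1) =
      Ioc α m ×ˢ univ := by
    ext y; simp; omega
  rw [this, card_product, Nat.card_Ioc, card_univ, Fintype.card_bool, mul_comm]

theorem card_filter_product_univ_le (m : ℕ) (α : ℕ) (hα : α ≤ m) :
    ((range (m + 1) ×ˢ (univ : Finset Bool)).filter fun y => α < y.1 ∨ y.1 = α).card =
      2 * (m - α) + 2 := by
  have : ((range (m + 1) ×ˢ (univ : Finset Bool)).filter fun y => α < y.1 ∨ y.1 = α) =
      Icc α m ×ˢ univ := by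
    ext y; simp; omega
  rw [this, card_product, Nat.card_Icc, card_univ, Fintype.card_bool]
  omega

theorem card_filter_product_univ_false (m : ℕ) (α : ℕ) (hα : α ≤ m) :
    ((range (m + 1) ×ˢ (univ : Finset Bool)).filter fun y =>
      α < y.1 ∨ y.1 = α ∧ y.2 = false).card = 2 * (m - α) + 1 := by
  have : ((range (m + 1) ×ˢ (univ : Finset Bool)).filter fun y =>
      α < y.1 ∨ y.1 = α ∧ y.2 = false) =
      insert (α, false) ((range (m + 1) ×ˢ (univ : Finset Bool)).filter fun y => α < y.1) := by
    ext ⟨a, b⟩; simp; grind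
  rw [this, card_insert_of_notMem (by simp), card_filter_product_univ m α]

theorem prod_ite_lt {n : ℕ} (p : Fin n) (A B : ℕ) :
    ∏ j : Fin n, (if j = p then 1 else if j < p then A else B) =
      A ^ (p : ℕ) * B ^ (n - 1 - p) := by
  have : ∀ j : Fin n, (if j = p then 1 else if j < p then A else B) =
      (if j < p then A else 1) * (if p < j then B else 1) := by
    intro j
    rcases lt_trichotomy j p with h | h | h
    · simp [h, h.ne, h.not_gt]
    · simp [h]
    · simp [h, h.ne', h.not_gt]
  simp_rw [this, prod_mul_distrib]
  rw [← prod_filter, ← prod_filter, prod_const, prod_const]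
  congr 2
  · rw [← Fin.card_Iio p]; congr 1; ext; simp
  · rw [← Fin.card_Ioi p]; congr 1; ext; simp

theorem card_piFinset_lowerCell {n m : ℕ} (p : Fin n) (ε : Bool) (α : ℕ) :
    (Fintype.piFinset (lowerCell m p ε α)).card = (2 * (m - α)) ^ (n - 1) := by
  rw [Fintype.card_piFinset]
  have : ∀ j, (lowerCell m p ε α j).card = if j = p then 1 else
      if j < p then 2 * (m - α) else 2 * (m - α) := by
    intro j
    unfold lowerCell
    split_ifs
    · rfl
    all_goals exact card_filter_product_univ m α
  simp_rw [this]
  rw [prod_ite_lt, ← pow_add]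
  congr 1
  omega

theorem card_piFinset_upperCell {n m : ℕ} (p : Fin n) (ε : Bool) (α : ℕ) (hα : α ≤ m) :
    (Fintype.piFinset (upperCell m p ε α)).card =
      (if ε = false ∧ α ≠ 0 then 2 * (m - α) + 2 else 2 * (m - α)) ^ (p : ℕ) *
        (2 * (m - α) + 1) ^ (n - 1 - p) := by
  rw [Fintype.card_piFinset, ← prod_ite_lt]
  refine prod_congr rfl fun j _ => ?_
  unfold upperCell
  split_ifs with h1 h2 h3
  · rfl
  · simp only [h3.1, h3.2, ne_eq, not_false_eq_true, and_self, and_true]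
    exact card_filter_product_univ_le m α hα
  · simp only [h3, and_false, or_false]
    exact card_filter_product_univ m α
  · exact card_filter_product_univ_false m α hα

theorem card_admissible_pos {n : ℕ} (m : ℕ) :
    ((coloured (n + 2) m).filter fun x => Admissible x ∧
      ¬ (x (Tuple.sort (sortKey x) 0)).1 = 0).card = (2 * m) ^ (n + 2) := by
  have : ((coloured (n + 2) m).filter fun x => Admissible x ∧
      ¬ (x (Tuple.sort (sortKey x) 0)).1 = 0) =
      Fintype.piFinset fun _ => (range (m + 1) ×ˢ univ).filter fun y => 0 < y.1 := by
    ext x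
    rw [mem_filter, mem_coloured, Fintype.mem_piFinset]
    simp only [mem_filter, mem_product, mem_range, mem_univ, and_true]
    constructor
    · rintro ⟨h1, -, h2⟩ j
      have := sortKey_le_iff.1 (sort_zero_le (x := x) j)
      exact ⟨Nat.lt_succ_of_le (h1 j), by omega⟩
    · intro h
      exact ⟨fun j => Nat.le_of_lt_succ (h j).1, Or.inl (h _).2, (h _).2.ne'⟩
  rw [this, Fintype.card_piFinset]
  simp only [card_filter_product_univ m 0, prod_const, card_univ, Fintype.card_fin, Nat.sub_zero]

theorem card_admissible {n : ℕ} (m : ℕ) :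
    (((coloured (n + 2) m).filter Admissible).card : ℤ) =
      (2 * m) ^ (n + 2) + ∑ p : Fin (n + 2), ∑ ε : Bool, ∑ α ∈ range (m + 1),
        ((if ε = false ∧ α ≠ 0 then 2 * ((m - α : ℕ) : ℤ) + 2 else 2 * (m - α : ℕ)) ^ (p : ℕ) *
          (2 * ((m - α : ℕ) : ℤ) + 1) ^ (n + 1 - p) - (2 * ((m - α : ℕ) : ℤ)) ^ (n + 1)) := by
  have hsplit := card_filter_add_card_filter_not (s := (coloured (n + 2) m).filter Admissible)
    (fun x => (x (Tuple.sort (sortKey x) 0)).1 = 0)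
  rw [filter_filter, filter_filter, card_admissible_pos,
    card_eq_sum_card_fiberwise (f := fun x => (Tuple.sort (sortKey x) 0,
      (x (Tuple.sort (sortKey x) 0)).2, (x (Tuple.sort (sortKey x) 1)).1))
      (t := univ ×ˢ univ ×ˢ range (m + 1)) (fun x hx => by
        have := mem_coloured.1 (mem_filter.1 hx).1 (Tuple.sort (sortKey x) 1)
        simp; omega)] at hsplit
  rw [← hsplit, Nat.cast_add, add_comm, sum_product]
  push_cast
  congr 1
  refine sum_congr rfl fun p _ => ?_
  rw [sum_product]
  refine sum_congr rfl fun ε _ => sum_congr rfl fun α hα => ?_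
  have hα' : α ≤ m := Nat.le_of_lt_succ (mem_range.1 hα)
  rw [fiber_admissible, cast_card_sdiff
    (Fintype.piFinset_subset _ _ (lowerCell_subset_upperCell p ε α)),
    card_piFinset_upperCell p ε α hα', card_piFinset_lowerCell p ε α]
  push_cast
  rfl

theorem sum_geom_succ (n : ℕ) (A : ℤ) :
    ∑ p : Fin (n + 2), A ^ (p : ℕ) * (A + 1) ^ (n + 1 - p) = (A + 1) ^ (n + 2) - A ^ (n + 2) := by
  rw [Fin.sum_univ_eq_sum_range fun p => A ^ p * (A + 1) ^ (n + 1 - p)]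
  have := geom_sum₂_mul A (A + 1) (n + 2)
  simp only [show n + 2 - 1 = n + 1 by omega] at this
  linarith

theorem sum_geom_pred (n : ℕ) (A : ℤ) :
    ∑ p : Fin (n + 2), (A + 1) ^ (p : ℕ) * A ^ (n + 1 - p) = (A + 1) ^ (n + 2) - A ^ (n + 2) := by
  rw [Fin.sum_univ_eq_sum_range fun p => (A + 1) ^ p * A ^ (n + 1 - p)]
  have := geom_sum₂_mul (A + 1) A (n + 2)
  simp only [show n + 2 - 1 = n + 1 by omega] at this
  linarith

/-- Put $M=m-\alpha$ and $N=n+2$. For $\alpha\neq0$ the two signs give $(2M+1)^N-(2M)^N$ and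
$(2M+2)^N-(2M+1)^N$, whose sum telescopes over $M<m$ to $(2m)^N$. For $\alpha=0$ both signs give
$(2m+1)^N-(2m)^N$. The powers of $2m$ then cancel against the functions with positive least value,
and the lower products contribute the power sum. -/
theorem card_admissible_eq {n : ℕ} (m : ℕ) :
    (((coloured (n + 2) m).filter Admissible).card : ℤ) =
      2 * (1 + 2 * m) ^ (n + 2) -
        (n + 2) * 2 ^ (n + 2) * ∑ j ∈ Icc 1 m, (j : ℤ) ^ (n + 1) := by
  have hT : ∀ m : ℕ, ∑ M ∈ range m, ((2 * (M : ℤ) + 2) ^ (n + 2) - (2 * (M : ℤ)) ^ (n + 2)) =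
      (2 * (m : ℤ)) ^ (n + 2) := by
    intro m
    have := sum_range_sub (fun M : ℕ => (2 * (M : ℤ)) ^ (n + 2)) m
    simp only [Nat.cast_add, Nat.cast_one, Nat.cast_zero, mul_zero, mul_add, mul_one] at this
    rw [this]; simp
  have hI : ∑ j ∈ Icc 1 m, (j : ℤ) ^ (n + 1) = ∑ M ∈ range m, (M : ℤ) ^ (n + 1) + m ^ (n + 1) := by
    rw [← sum_range_succ, range_eq_Ico, sum_eq_sum_Ico_succ_bot (by omega)]
    simp; rfl
  have hin : ∀ M : ℕ, ∑ p : Fin (n + 2), ∑ ε : Bool,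
      ((if ε = false then 2 * (M : ℤ) + 2 else 2 * M) ^ (p : ℕ) *
          (2 * (M : ℤ) + 1) ^ (n + 1 - p) - (2 * (M : ℤ)) ^ (n + 1)) =
      ((2 * (M : ℤ) + 2) ^ (n + 2) - (2 * (M : ℤ)) ^ (n + 2)) -
        2 * (n + 2) * 2 ^ (n + 1) * (M : ℤ) ^ (n + 1) := by
    intro M
    have h1 := sum_geom_succ n (2 * M)
    have h2 := sum_geom_pred n (2 * M + 1)
    rw [show 2 * (M : ℤ) + 1 + 1 = 2 * M + 2 by ring] at h2
    simp only [Fintype.sum_bool, sum_add_distrib, sum_sub_distrib, if_true, Bool.true_eq_false,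
      if_false, h1, h2, sum_const, card_univ, Fintype.card_fin, Fintype.card_bool,
      nsmul_eq_mul]
    push_cast
    ring
  have h0 : ∑ p : Fin (n + 2), ∑ _ε : Bool, ((2 * (m : ℤ)) ^ (p : ℕ) *
          (2 * (m : ℤ) + 1) ^ (n + 1 - p) - (2 * (m : ℤ)) ^ (n + 1)) =
      2 * ((2 * (m : ℤ) + 1) ^ (n + 2) - (2 * (m : ℤ)) ^ (n + 2)) -
        2 * (n + 2) * 2 ^ (n + 1) * (m : ℤ) ^ (n + 1) := by
    have h1 := sum_geom_succ n (2 * m)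
    simp only [sum_sub_distrib, sum_const, card_univ, Fintype.card_fin, Fintype.card_bool,
      nsmul_eq_mul, ← mul_sum, h1]
    push_cast
    ring
  rw [card_admissible]
  -- Reindexing by `α = m - M` isolates the exceptional term `α = 0`.
  have hswap : ∀ f : Fin (n + 2) → Bool → ℕ → ℤ, ∑ p, ∑ ε, ∑ α ∈ range (m + 1), f p ε α =
      (∑ M ∈ range m, ∑ p, ∑ ε, f p ε (m - M)) + ∑ p, ∑ ε, f p ε 0 := by
    intro f
    have : ∑ p, ∑ ε, ∑ α ∈ range (m + 1), f p ε α =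
        ∑ α ∈ range (m + 1), ∑ p, ∑ ε, f p ε α :=
      (sum_congr rfl fun p _ => sum_comm).trans sum_comm
    rw [this, ← sum_range_reflect, sum_range_succ]
    simp
  rw [hswap]
  have e1 : ∀ M ∈ range m, ∑ p : Fin (n + 2), ∑ ε : Bool,
      ((if ε = false ∧ m - M ≠ 0 then 2 * ((m - (m - M) : ℕ) : ℤ) + 2 else
        2 * (m - (m - M) : ℕ)) ^ (p : ℕ) * (2 * ((m - (m - M) : ℕ) : ℤ) + 1) ^ (n + 1 - p) -
          (2 * ((m - (m - M) : ℕ) : ℤ)) ^ (n + 1)) =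
      ((2 * (M : ℤ) + 2) ^ (n + 2) - (2 * (M : ℤ)) ^ (n + 2)) -
        2 * (n + 2) * 2 ^ (n + 1) * (M : ℤ) ^ (n + 1) := by
    intro M hM
    rw [mem_range] at hM
    rw [← hin M, Nat.sub_sub_self hM.le]
    have : m - M ≠ 0 := by omega
    simp only [this, ne_eq, not_false_eq_true, and_true]
  rw [sum_congr rfl e1, sum_sub_distrib, hT, ← mul_sum, hI]
  simp only [ne_eq, not_true_eq_false, and_false, if_false, Nat.sub_zero]
  rw [h0]
  ring

/-! ### Signed permutations as a permutation with a sign for each letter -/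

variable {n : ℕ}

theorem letter_mem (j : Fin n) (ε : Bool) :
    letter j ε ∈ (Icc (-(n : ℤ)) n).erase 0 := by
  have := natAbs_letter j ε
  have := j.2
  rw [mem_erase, mem_Icc]
  omega

theorem exists_letter_eq (a : Letter n) : ∃ (j : Fin n) (ε : Bool), (a : ℤ) = letter j ε := by
  have h := a.2
  rw [mem_erase, mem_Icc] at h
  refine ⟨⟨(a : ℤ).natAbs - 1, by omega⟩, decide ((a : ℤ) < 0), ?_⟩
  by_cases h0 : (a : ℤ) < 0
  · simp only [h0, decide_true, letter_true]; omega
  · simp only [h0, decide_false, letter_false]; omega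

theorem letter_inj {i j : Fin n} {ε δ : Bool} : letter i ε = letter j δ ↔ i = j ∧ ε = δ := by
  constructor
  · intro h
    have hij : i = j := by
      by_contra hij
      exact letter_ne hij _ _ h
    subst hij
    refine ⟨rfl, ?_⟩
    revert h
    cases ε <;> cases δ <;> simp <;> omega
  · rintro ⟨rfl, rfl⟩; rfl

theorem neg_letter (j : Fin n) (ε : Bool) : -letter j ε = letter j !ε := by
  cases ε <;> simp

/-- The alphabet `{±1, …, ±n}` consists of the signed elements of `Fin n`. -/
noncomputable def letterEquiv (n : ℕ) : Fin n × Bool ≃ Letter n :=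
  Equiv.ofBijective (fun x => ⟨letter x.1 x.2, letter_mem x.1 x.2⟩)
    ⟨fun x y h => Prod.ext_iff.2 (letter_inj.1 (congrArg Subtype.val h)), fun a => by
      obtain ⟨j, ε, h⟩ := exists_letter_eq a
      exact ⟨(j, ε), Subtype.ext h.symm⟩⟩

theorem coe_letterEquiv (x : Fin n × Bool) : (letterEquiv n x : ℤ) = letter x.1 x.2 := rfl

theorem neg_letterEquiv (j : Fin n) (ε : Bool) :
    -letterEquiv n (j, ε) = letterEquiv n (j, !ε) :=
  Subtype.ext (neg_letter j ε)

/-- The action of `σ` on the absolute values, followed by the sign change at the letters in `s`. -/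
def signedAction (σ : Equiv.Perm (Fin n)) (s : Fin n → Bool) : Equiv.Perm (Fin n × Bool) where
  toFun x := (σ x.1, xor x.2 (s (σ x.1)))
  invFun x := (σ.symm x.1, xor x.2 (s x.1))
  left_inv x := by simp
  right_inv x := by simp

/-- The signed permutation with absolute values given by `σ` and with minus signs at the letters
in `s`. -/
noncomputable def ofSigns (c : Equiv.Perm (Fin n) × (Fin n → Bool)) : Equiv.Perm (Letter n) :=
  (letterEquiv n).permCongr (signedAction c.1 c.2)

theorem ofSigns_letterEquiv (c : Equiv.Perm (Fin n) × (Fin n → Bool)) (x : Fin n × Bool) :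
    ofSigns c (letterEquiv n x) = letterEquiv n (c.1 x.1, xor x.2 (c.2 (c.1 x.1))) := by
  simp [ofSigns, signedAction, Equiv.permCongr_apply]

theorem val_letter (π : Equiv.Perm (Letter n)) (j : Fin n) (ε : Bool) :
    val π (letter j ε) = π (letterEquiv n (j, ε)) :=
  dif_pos (letter_mem j ε)

theorem val_ofSigns (c : Equiv.Perm (Fin n) × (Fin n → Bool)) (i : Fin n) :
    val (ofSigns c) ((i : ℤ) + 1) = letter (c.1 i) (c.2 (c.1 i)) := by
  rw [← letter_false, val_letter, ofSigns_letterEquiv, coe_letterEquiv, Bool.false_xor]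

theorem mem_groupB {π : Equiv.Perm (Letter n)} : π ∈ groupB n ↔ ∀ a, π (-a) = -π a := by
  simp [groupB]

theorem ofSigns_mem_groupB (c : Equiv.Perm (Fin n) × (Fin n → Bool)) : ofSigns c ∈ groupB n := by
  rw [mem_groupB]
  intro a
  obtain ⟨⟨j, ε⟩, rfl⟩ := (letterEquiv n).surjective a
  rw [neg_letterEquiv, ofSigns_letterEquiv, ofSigns_letterEquiv, neg_letterEquiv]
  simp

theorem ofSigns_injective : Function.Injective (ofSigns (n := n)) := by
  rintro ⟨σ, s⟩ ⟨τ, t⟩ h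
  have hv := fun i => congrArg (fun π => val π (((i : Fin n) : ℤ) + 1)) h
  simp only [val_ofSigns, letter_inj] at hv
  obtain rfl : σ = τ := Equiv.ext fun i => (hv i).1
  rw [Prod.mk.injEq]
  exact ⟨rfl, funext fun j => by simpa using (hv (σ.symm j)).2⟩

theorem exists_ofSigns_eq {π : Equiv.Perm (Letter n)} (hπ : π ∈ groupB n) :
    ∃ c, ofSigns c = π := by
  rw [mem_groupB] at hπ
  set ρ : Fin n × Bool → Fin n × Bool := fun x => (letterEquiv n).symm (π (letterEquiv n x)) with hρ
  have hρπ : ∀ x, letterEquiv n (ρ x) = π (letterEquiv n x) := fun x => by simp [hρ]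
  have hneg : ∀ j ε, ρ (j, !ε) = ((ρ (j, ε)).1, !(ρ (j, ε)).2) := fun j ε =>
    (letterEquiv n).injective (by rw [hρπ, ← neg_letterEquiv, hπ, ← hρπ, ← neg_letterEquiv])
  have hinj : Function.Injective ρ :=
    (letterEquiv n).symm.injective.comp (π.injective.comp (letterEquiv n).injective)
  have hσ : Function.Injective fun i => (ρ (i, false)).1 := by
    intro i j hij
    simp only at hij
    -- If the signs differ, compatibility with negation makes the images of `i` and `-j` equal, so
    -- `i = j` in either case.
    by_cases h : (ρ (i, false)).2 = (ρ (j, false)).2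
    · exact congrArg Prod.fst (hinj (Prod.ext hij h))
    · have : ρ (i, false) = ρ (j, !false) := by
        rw [hneg]
        exact Prod.ext hij (Bool.eq_not.2 h)
      exact congrArg Prod.fst (hinj this)
  set σ := Equiv.ofBijective _ (Finite.injective_iff_bijective.1 hσ) with hσdef
  refine ⟨(σ, fun j => (ρ (σ.symm j, false)).2), Equiv.ext fun a => ?_⟩
  obtain ⟨⟨j, ε⟩, rfl⟩ := (letterEquiv n).surjective a
  rw [ofSigns_letterEquiv, ← hρπ]
  congr 1
  cases ε
  · simp [hσdef]
  · rw [show true = !false from rfl, hneg]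
    simp [hσdef]

theorem neg_ofSigns (c : Equiv.Perm (Fin n) × (Fin n → Bool)) :
    neg (ofSigns c) = (univ.filter fun j => c.2 j = true).card := by
  symm
  have hneg : ∀ i : Fin n, val (ofSigns c) (((i : ℕ) + 1 : ℕ) : ℤ) < 0 ↔ c.2 (c.1 i) = true := by
    intro i
    rw [Nat.cast_add, Nat.cast_one, val_ofSigns]
    cases c.2 (c.1 i) <;> simp <;> omega
  refine card_bij (fun j _ => (c.1.symm j : ℕ) + 1) ?_ ?_ ?_
  · intro j hj
    rw [mem_filter, hneg, mem_Icc]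
    have := (c.1.symm j).2
    exact ⟨by omega, by simpa using hj⟩
  · intro i _ j _ h
    exact c.1.symm.injective (Fin.ext (by omega))
  · intro i hi
    rw [mem_filter, mem_Icc] at hi
    obtain ⟨i, rfl⟩ := Nat.exists_eq_add_of_le' hi.1.1
    exact ⟨c.1 ⟨i, by omega⟩, by simpa using (hneg ⟨i, by omega⟩).1 hi.2, by simp⟩

theorem zero_mem_DesD (c : Equiv.Perm (Fin (n + 2)) × (Fin (n + 2) → Bool)) :
    0 ∈ DesD (ofSigns c) ↔ letter (c.1 0) (c.2 (c.1 0)) + letter (c.1 1) (c.2 (c.1 1)) < 0 := by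
  have h1 := val_ofSigns c 0
  have h2 := val_ofSigns c 1
  norm_num at h1 h2
  rw [DesD, h1, h2]
  split_ifs with h
  · simpa using h
  · simpa [DesA] using h

theorem succ_mem_DesD (c : Equiv.Perm (Fin (n + 2)) × (Fin (n + 2) → Bool)) (i : Fin (n + 1)) :
    (i : ℕ) + 1 ∈ DesD (ofSigns c) ↔
      letter (c.1 i.succ) (c.2 (c.1 i.succ)) < letter (c.1 i.castSucc) (c.2 (c.1 i.castSucc)) := by
  have h1 := val_ofSigns c i.succ
  have h2 := val_ofSigns c i.castSucc
  have : (i : ℕ) + 1 ∈ DesD (ofSigns c) ↔ (i : ℕ) + 1 ∈ DesA (ofSigns c) := by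
    unfold DesD; split_ifs <;> simp
  rw [this, DesA, mem_filter, mem_Ico, ← h1, ← h2]
  have := i.2
  simp
  omega

theorem DesD_subset (hn : 1 ≤ n) (π : Equiv.Perm (Letter n)) : DesD π ⊆ range n := by
  have : DesA π ⊆ range n := fun i hi => by
    have := mem_Ico.1 (mem_filter.1 hi).1
    exact mem_range.2 this.2
  unfold DesD
  split_ifs
  · exact insert_subset (mem_range.2 (by omega)) this
  · exact this

/-! ### Passing from all signed permutations to type D -/

/-- Change the sign of the smallest letter. -/
def flipSign (c : Equiv.Perm (Fin (n + 2)) × (Fin (n + 2) → Bool)) :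
    Equiv.Perm (Fin (n + 2)) × (Fin (n + 2) → Bool) :=
  (c.1, Function.update c.2 0 !c.2 0)

theorem flipSign_flipSign (c : Equiv.Perm (Fin (n + 2)) × (Fin (n + 2) → Bool)) :
    flipSign (flipSign c) = c := by
  simp [flipSign]

/-- Index 0 carries the letter ±1, and every other letter has absolute value at least 2. The sign of
a difference or a sum with ±1 is thus decided by the other letter. -/
theorem letter_update_lt {s : Fin (n + 2) → Bool} {i j : Fin (n + 2)} (hij : i ≠ j) :
    (letter i (Function.update s 0 (!s 0) i) < letter j (Function.update s 0 (!s 0) j) ↔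
      letter i (s i) < letter j (s j)) ∧
    (letter i (Function.update s 0 (!s 0) i) + letter j (Function.update s 0 (!s 0) j) < 0 ↔
      letter i (s i) + letter j (s j) < 0) := by
  have h0 : ((0 : Fin (n + 2)) : ℕ) = 0 := rfl
  by_cases hi : i = 0
  · subst hi
    have hj : (j : ℕ) ≠ 0 := fun h => hij (Fin.ext h.symm)
    rw [Function.update_self, Function.update_of_ne hij.symm]
    cases s 0 <;> cases s j <;> simp <;> omega
  · by_cases hj : j = 0
    · subst hj
      have hi : (i : ℕ) ≠ 0 := fun h => hij (Fin.ext h)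
      rw [Function.update_self, Function.update_of_ne hij]
      cases s 0 <;> cases s i <;> simp <;> omega
    · rw [Function.update_of_ne hi, Function.update_of_ne hj]
      exact ⟨Iff.rfl, Iff.rfl⟩

theorem DesD_flipSign (c : Equiv.Perm (Fin (n + 2)) × (Fin (n + 2) → Bool)) :
    DesD (ofSigns (flipSign c)) = DesD (ofSigns c) := by
  ext i
  by_cases hi : i < n + 2
  · cases i with
    | zero =>
      rw [zero_mem_DesD, zero_mem_DesD]
      exact (letter_update_lt (c.1.injective.ne (by simp))).2
    | succ i =>
      rw [succ_mem_DesD _ ⟨i, by omega⟩, succ_mem_DesD _ ⟨i, by omega⟩]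
      exact (letter_update_lt (c.1.injective.ne (Fin.castSucc_lt_succ).ne')).1
  · have h := fun c => DesD_subset (n := n + 2) (by omega) (ofSigns c)
    exact iff_of_false (fun h' => hi (mem_range.1 (h _ h'))) fun h' => hi (mem_range.1 (h _ h'))

theorem even_neg_flipSign (c : Equiv.Perm (Fin (n + 2)) × (Fin (n + 2) → Bool)) :
    Even (neg (ofSigns (flipSign c))) ↔ ¬ Even (neg (ofSigns c)) := by
  have hc : ∀ s : Fin (n + 2) → Bool, (univ.filter fun j => s j = true).card =
      (if s 0 = true then 1 else 0) + ∑ i : Fin (n + 1), if s i.succ = true then 1 else 0 :=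
    fun s => by rw [card_filter, Fin.sum_univ_succ]
  rw [neg_ofSigns, neg_ofSigns, ← Nat.even_add_one, hc, hc]
  simp only [flipSign]
  have : ∀ i : Fin (n + 1), Function.update c.2 0 (!c.2 0) i.succ = c.2 i.succ := fun i =>
    Function.update_of_ne (Fin.succ_ne_zero i) _ _
  simp only [this, Function.update_self]
  cases c.2 0 <;> simp [Nat.even_add_one, add_comm, parity_simps]

/-- `flipSign` is an involution exchanging the two parities and fixing the descent set, so both
parity classes contribute equally. -/
theorem sum_groupD (f : Finset ℕ → ℕ) :
    2 * ∑ π ∈ groupD (n + 2), f (DesD π) =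
      ∑ c : Equiv.Perm (Fin (n + 2)) × (Fin (n + 2) → Bool), f (DesD (ofSigns c)) := by
  have h1 : ∑ c : Equiv.Perm (Fin (n + 2)) × (Fin (n + 2) → Bool) with
      Even (neg (ofSigns c)), f (DesD (ofSigns c)) =
      ∑ π ∈ groupD (n + 2), f (DesD π) := by
    refine sum_bij (fun c _ => ofSigns c) ?_ ?_ ?_ ?_
    · intro c hc
      exact mem_filter.2 ⟨ofSigns_mem_groupB c, (mem_filter.1 hc).2⟩
    · exact fun _ _ _ _ h => ofSigns_injective h
    · intro π hπ
      obtain ⟨h, he⟩ := mem_filter.1 hπ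
      obtain ⟨c, rfl⟩ := exists_ofSigns_eq h
      exact ⟨c, mem_filter.2 ⟨mem_univ _, he⟩, rfl⟩
    · exact fun _ _ => rfl
  have h2 : ∑ c : Equiv.Perm (Fin (n + 2)) × (Fin (n + 2) → Bool) with
      ¬ Even (neg (ofSigns c)), f (DesD (ofSigns c)) =
      ∑ c : Equiv.Perm (Fin (n + 2)) × (Fin (n + 2) → Bool) with
        Even (neg (ofSigns c)), f (DesD (ofSigns c)) := by
    refine sum_bij' (fun c _ => flipSign c) (fun c _ => flipSign c) ?_ ?_ ?_ ?_ ?_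
    · intro c hc
      exact mem_filter.2 ⟨mem_univ _, (even_neg_flipSign c).2 (mem_filter.1 hc).2⟩
    · intro c hc
      exact mem_filter.2 ⟨mem_univ _, fun h => (even_neg_flipSign c).1 h (mem_filter.1 hc).2⟩
    · exact fun c _ => flipSign_flipSign c
    · exact fun c _ => flipSign_flipSign c
    · exact fun c _ => by rw [DesD_flipSign]
  rw [← sum_filter_add_sum_filter_not univ fun c => Even (neg (ofSigns c)), h2, h1, two_mul]

/-! ### The power-sum identity -/

theorem sum_choose_mul_eulerianD (m : ℕ) :
    ∑ k ∈ range (n + 2 + 1), (n + 2 + m - k).choose (n + 2) * eulerianD (n + 2) k =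
      ∑ π ∈ groupD (n + 2), (strictSeq (n + 2) m (DesD π)).card := by
  rw [← sum_fiberwise_of_maps_to (t := range (n + 2 + 1)) (g := desD)]
  · refine sum_congr rfl fun k _ => ?_
    rw [eulerianD, mul_comm, ← smul_eq_mul, ← sum_const]
    refine sum_congr rfl fun π hπ => ?_
    have h := DesD_subset (n := n + 2) (by omega) π
    rw [card_strictSeq, filter_true_of_mem fun i hi => mem_range.1 (h hi), ← (mem_filter.1 hπ).2,
      desD]
  · intro π _
    have := card_le_card (DesD_subset (n := n + 2) (by omega) π)
    rw [card_range] at this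
    exact mem_range.2 (Nat.lt_succ_of_le this)

theorem worpitzky_powerSum (m : ℕ) :
    (1 + 2 * (m : ℤ)) ^ (n + 2) -
        2 ^ (n + 1) * (((n + 2 : ℕ) : ℤ) * ∑ j ∈ Icc 1 m, (j : ℤ) ^ (n + 1)) =
      ∑ k ∈ range (n + 2 + 1),
        ((n + 2 + m - k).choose (n + 2) : ℤ) * (eulerianD (n + 2) k : ℤ) := by
  have h := card_admissible_eq (n := n) m
  rw [← sum_card_strictSeq m (fun c => DesD (ofSigns c)) succ_mem_DesD zero_mem_DesD,
    ← sum_groupD fun D => (strictSeq (n + 2) m D).card, ← sum_choose_mul_eulerianD] at h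
  push_cast at h ⊢
  rw [pow_succ 2 (n + 1)] at h
  linarith

end

/-! ### The Bernoulli form -/

theorem worpitzky_bernoulli_natCast (n m : ℕ) (K : Type*) [Field K] [CharZero K] :
    (1 + 2 * (m : K)) ^ (n + 2) - 2 ^ (n + 1) *
        (Polynomial.aeval ((m : K) + 1) (Polynomial.bernoulli (n + 2)) -
          ((bernoulli (n + 2) : ℚ) : K)) =
      ∑ k ∈ Finset.range (n + 2 + 1),
        Ring.choose (((n + 2 : ℕ) : K) + m - (k : K)) (n + 2) * (eulerianD (n + 2) k : K) := by
  have h := congrArg (Int.cast : ℤ → K) (worpitzky_powerSum (n := n) m)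
  have hB : Polynomial.aeval ((m : K) + 1) (Polynomial.bernoulli (n + 2)) -
      ((bernoulli (n + 2) : ℚ) : K) =
      ((n + 2 : ℕ) : K) * ∑ j ∈ Finset.Icc 1 m, (j : K) ^ (n + 1) := by
    have hq := Polynomial.sum_range_pow_eq_bernoulli_sub (m + 1) (n + 1)
    have he : (m : K) + 1 = algebraMap ℚ K ((m + 1 : ℕ) : ℚ) := by simp
    rw [he, Polynomial.aeval_algebraMap_apply_eq_algebraMap_eval, eq_ratCast, ← Rat.cast_sub,
      ← Nat.succ_eq_add_one (n + 1), ← hq, Finset.range_eq_Ico,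
      -- The extra summand at 0 is `0 ^ (n + 1) = 0`.
      Finset.sum_eq_sum_Ico_succ_bot (Nat.succ_pos m)]
    have hI : Finset.Ico (0 + 1) (m + 1) = Finset.Icc 1 m := rfl
    rw [hI]
    push_cast
    ring
  rw [hB]
  push_cast at h ⊢
  rw [h]
  refine Finset.sum_congr rfl fun k hk => ?_
  have hk' : k ≤ n + 2 + m := by
    have := Finset.mem_range.1 hk
    omega
  rw [← Ring.choose_natCast, Nat.cast_sub hk']
  push_cast
  rfl

open Polynomial in
-- Both sides are polynomial in `x`, and in characteristic zero the natural numbers provide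
-- infinitely many points of agreement.
theorem worpitzky_bernoulli (n : ℕ) {K : Type*} [Field K] [CharZero K] (x : K) :
    (1 + 2 * x) ^ (n + 2) - 2 ^ (n + 1) *
        (aeval (x + 1) (Polynomial.bernoulli (n + 2)) - ((_root_.bernoulli (n + 2) : ℚ) : K)) =
      ∑ k ∈ Finset.range (n + 2 + 1),
        Ring.choose (((n + 2 : ℕ) : K) + x - (k : K)) (n + 2) * (eulerianD (n + 2) k : K) := by
  set P : K[X] := (1 + C 2 * X) ^ (n + 2) - C (2 ^ (n + 1)) *
    (((Polynomial.bernoulli (n + 2)).map (algebraMap ℚ K)).comp (X + 1) -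
      C ((_root_.bernoulli (n + 2) : ℚ) : K)) with hP
  set Q : K[X] := ∑ k ∈ Finset.range (n + 2 + 1), C (((n + 2).factorial : K)⁻¹) *
    ((descPochhammer ℤ (n + 2)).map (algebraMap ℤ K)).comp (C ((n + 2 : ℕ) : K) + X - C (k : K)) *
      C (eulerianD (n + 2) k : K) with hQ
  have evalP : ∀ y, P.eval y = (1 + 2 * y) ^ (n + 2) - 2 ^ (n + 1) *
      (aeval (y + 1) (Polynomial.bernoulli (n + 2)) -
        ((_root_.bernoulli (n + 2) : ℚ) : K)) := fun y => by
    simp [hP, eval_comp, eval_map_algebraMap]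
  have evalQ : ∀ y, Q.eval y = ∑ k ∈ Finset.range (n + 2 + 1),
      Ring.choose (((n + 2 : ℕ) : K) + y - (k : K)) (n + 2) * (eulerianD (n + 2) k : K) :=
      fun y => by
    rw [hQ, eval_finsetSum]
    refine Finset.sum_congr rfl fun k _ => ?_
    rw [Ring.choose_eq_smul, ← aeval_eq_smeval, smul_eq_mul]
    simp only [eval_mul, eval_C, eval_comp, eval_map_algebraMap, eval_add, eval_sub, eval_X]
  have hPQ : P = Q := by
    refine eq_of_infinite_eval_eq P Q ((Set.infinite_range_of_injective
      (Nat.cast_injective (R := K))).mono ?_)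
    rintro _ ⟨m, rfl⟩
    rw [Set.mem_ofPred_eq, evalP, evalQ]
    exact worpitzky_bernoulli_natCast n m K
  rw [← evalP, ← evalQ, hPQ]

end SignedPerm

theorem proposition4p1 (n : ℕ) (hn : 2 ≤ n) :
    (∀ {K : Type*} [Field K] [CharZero K] (x : K),
      (1 + 2 * x) ^ n - 2 ^ (n - 1) *
          (Polynomial.aeval (x + 1) (Polynomial.bernoulli n) - ((bernoulli n : ℚ) : K)) =
        ∑ k ∈ Finset.range (n + 1),
          Ring.choose ((n : K) + x - (k : K)) n * (SignedPerm.eulerianD n k : K)) ∧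
    (∀ m : ℕ,
      (1 + 2 * (m : ℤ)) ^ n - 2 ^ (n - 1) * ((n : ℤ) * ∑ j ∈ Finset.Icc 1 m, (j : ℤ) ^ (n - 1)) =
        ∑ k ∈ Finset.range (n + 1),
          ((n + m - k).choose n : ℤ) * (SignedPerm.eulerianD n k : ℤ)) := by
  obtain ⟨n, rfl⟩ := Nat.exists_eq_add_of_le' hn
  exact ⟨fun x => SignedPerm.worpitzky_bernoulli n x, SignedPerm.worpitzky_powerSum⟩
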